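/- Let $I:=[0,1]\cup\{\infty\}$, and for $\tau\in[0,1]$, $\kappa\in\{1,2\}$ and $x,y\in I$ let $\chi[\tau,\kappa](x,y):=x$ if $\kappa=1$ and $x>\tau$, $\;:=\infty$ if $\kappa=1$ and $x\le\tau$, and $\;:=x\wedge y$ if $\kappa=2$. A probability measure $\rho$ on $I$ solves the RDE if $\chi[\omega](Y_1,Y_2)$ has law $\rho$ whenever $Y_1,Y_2$ have law $\rho$, $\omega$ is uniformly distributed on $[0,1]\times\{1,2\}$, and $\omega,Y_1,Y_2$ are independent. For $t>0$ let $\psi_t(y):=t^{-1}y$ if $y\le t$ and $\psi_t(y):=\infty$ otherwise ($y\in I$), and let $\Gamma_t\rho:=t^{-1}\,\rho\circ\psi_t^{-1}+(1-t^{-1})\,\delta_\infty$, a priori a signed measure. (a) If $\rho$ solves the RDE, then $\rho([0,t])\le t$ for all $0\le t\le 1$, and for every $t>0$ the signed measure $\Gamma_t\rho$ is a probability measure that solves the RDE. (b) For each $\Xi\subset(0,1]$ that is closed in the relative topology of $(0,1]$ there is a unique probability measure $\rho_\Xi$ on $I$ that solves the RDE, is concentrated on $\Xi\cup\{\infty\}$,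 and satisfies $\rho_\Xi([0,s])\ge\tfrac12 s$ for all $s\in\Xi$. For every such $\Xi$ and every $t>0$, the set $\Xi':=\{t^{-1}y:y\in\Xi\}\cap[0,1]$ is again a relatively closed subset of $(0,1]$, and $\Gamma_t\rho_\Xi=\rho_{\Xi'}$. -/

import Mathlib

open MeasureTheory Set
open scoped ENNReal

noncomputable section

namespace FrozenPercolation

/-- The space `I = [0,1] ∪ {∞}` of burning times, with the order, the topology and the Borel
σ-algebra it inherits from `[0,∞]`. -/
abbrev BurnTime : Type := {x : ℝ≥0∞ // x ≤ 1 ∨ x = ⊤}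

/-- The point `∞` of `I`. -/
def never : BurnTime := ⟨⊤, Or.inr rfl⟩

/-- The subset `[0,t]` of `I`, for real `t`. -/
def upTo (t : ℝ) : Set BurnTime := {x | (x : ℝ≥0∞) ≤ ENNReal.ofReal t}

/-- The map `χ[τ,κ](x,y)`: for `κ = 1` it is `x` if `x > τ` and `∞` if `x ≤ τ`;
for `κ = 2` it is `x ∧ y`. (Only the values `κ ∈ {1,2}` are ever used.) -/
def chi (τ : unitInterval) (κ : ℕ) (x y : BurnTime) : BurnTime :=
  if κ = 1 then (if ENNReal.ofReal (τ : ℝ) < (x : ℝ≥0∞) then x else never) else min x y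

/-- The uniform distribution on `[0,1] × {1,2}`. -/
def omegaLaw : Measure (unitInterval × ℕ) :=
  (volume : Measure unitInterval).prod
    ((2 : ℝ≥0∞)⁻¹ • Measure.dirac 1 + (2 : ℝ≥0∞)⁻¹ • Measure.dirac 2)

/-- The map `T`: the law of `χ[ω](Y₁,Y₂)`, where `Y₁, Y₂` have law `ρ`, `ω` is uniform on
`[0,1] × {1,2}`, and `ω, Y₁, Y₂` are independent. -/
def rdeMap (ρ : ProbabilityMeasure BurnTime) : Measure BurnTime :=
  Measure.map (fun p : (unitInterval × ℕ) × (BurnTime × BurnTime) =>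
      chi p.1.1 p.1.2 p.2.1 p.2.2)
    (omegaLaw.prod ((ρ : Measure BurnTime).prod (ρ : Measure BurnTime)))

/-- `ρ` solves the recursive distributional equation `T ρ = ρ`. -/
def SolvesRDE (ρ : ProbabilityMeasure BurnTime) : Prop :=
  rdeMap ρ = (ρ : Measure BurnTime)

/-- The space of all probability measures `ρ` on `I` with `ρ([0,t]) ≤ t` for `0 ≤ t ≤ 1`. -/
def scalable : Set (ProbabilityMeasure BurnTime) :=
  {ρ | ∀ t ∈ Icc (0 : ℝ) 1, (ρ : Measure BurnTime) (upTo t) ≤ ENNReal.ofReal t}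

/-- The scaling map `ψ_t : I → I`: `ψ_t(y) = t⁻¹ y` if `y ≤ t`, and `∞` otherwise. -/
def psi (t : ℝ) (y : BurnTime) : BurnTime :=
  if h : (y : ℝ≥0∞) ≤ ENNReal.ofReal t then
    ⟨(y : ℝ≥0∞) / ENNReal.ofReal t, Or.inl (ENNReal.div_le_of_le_mul (by rwa [one_mul]))⟩
  else never

/-- The signed measure `Γ_t ρ = t⁻¹ ρ ∘ ψ_t⁻¹ + (1 - t⁻¹) δ_∞`. -/
def Gamma (t : ℝ) (ρ : ProbabilityMeasure BurnTime) : SignedMeasure BurnTime :=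
  t⁻¹ • (Measure.map (psi t) (ρ : Measure BurnTime)).toSignedMeasure
    + (1 - t⁻¹) • (Measure.dirac never).toSignedMeasure

/-- `Ξ` is a subset of `(0,1]` that is closed in the relative topology of `(0,1]`. -/
def IsRelClosed (Ξ : Set ℝ) : Prop :=
  Ξ ⊆ Ioc 0 1 ∧ IsClosed ((↑) ⁻¹' Ξ : Set (Ioc (0 : ℝ) 1))

/-- The three conditions that characterise the law `ρ_Ξ`. -/
structure IsBurningLaw (Ξ : Set ℝ) (ρ : ProbabilityMeasure BurnTime) : Prop where
  /-- it solves the RDE -/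
  solves : SolvesRDE ρ
  /-- it is concentrated on `Ξ ∪ {∞}` -/
  concentrated : ∀ᵐ x ∂(ρ : Measure BurnTime),
    x = never ∨ ∃ s ∈ Ξ, (x : ℝ≥0∞) = ENNReal.ofReal s
  /-- `ρ([0,t]) ≥ t/2` for all `t ∈ Ξ` -/
  half_le : ∀ t ∈ Ξ, ENNReal.ofReal (t / 2) ≤ (ρ : Measure BurnTime) (upTo t)

/-- The rescaled set `Ξ' = {t⁻¹ y : y ∈ Ξ} ∩ [0,1]`. -/
def rescale (t : ℝ) (Ξ : Set ℝ) : Set ℝ :=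
  ((fun y => t⁻¹ * y) '' Ξ) ∩ Icc 0 1

/-- `χ` is measurable, so that the push-forward in `rdeMap` is the law it is meant to be. -/
theorem measurable_chi :
    Measurable (fun p : (unitInterval × ℕ) × (BurnTime × BurnTime) =>
      chi p.1.1 p.1.2 p.2.1 p.2.2) := by
  unfold chi
  refine Measurable.ite ?_ (Measurable.ite ?_ (by fun_prop) (by fun_prop)) ?_
  · exact (measurable_snd.comp measurable_fst) (measurableSet_singleton 1)
  · exact measurableSet_lt (by fun_prop) (by fun_prop)
  · refine Measurable.subtype_mk
      (f := fun p : (unitInterval × ℕ) × (BurnTime × BurnTime) => (min p.2.1 p.2.2).1) ?_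
    have h : (fun p : (unitInterval × ℕ) × (BurnTime × BurnTime) => (min p.2.1 p.2.2).1)
        = fun p => min p.2.1.1 p.2.2.1 := by
      funext p
      rcases le_total p.2.1 p.2.2 with h | h
      · rw [min_eq_left h, min_eq_left (show p.2.1.1 ≤ p.2.2.1 from h)]
      · rw [min_eq_right h, min_eq_right (show p.2.2.1 ≤ p.2.1.1 from h)]
    rw [h]
    fun_prop

/-- `ψ_t` is measurable, so that the push-forward in `Gamma` is the image measure. -/
theorem measurable_psi (t : ℝ) : Measurable (psi t) := by
  have h : psi t = fun y : BurnTime => (⟨(psi t y).1, (psi t y).2⟩ : BurnTime) := rfl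
  rw [h]
  refine Measurable.subtype_mk ?_
  have h2 : (fun y : BurnTime => (psi t y).1) = fun y : BurnTime =>
      if (y : ℝ≥0∞) ≤ ENNReal.ofReal t then (y : ℝ≥0∞) / ENNReal.ofReal t else ⊤ := by
    funext y
    unfold psi never
    split_ifs <;> rfl
  rw [h2]
  refine Measurable.ite ?_ (by fun_prop) (by fun_prop)
  exact measurableSet_le (by fun_prop) (by fun_prop)

end FrozenPercolation

end

open FrozenPercolation

noncomputable section

namespace FrozenPercolation

open Filter Topology

/-! Write F(t) = ρ([0,t]). Conditioning on κ, the RDE on [0,t] reads 2F = ∫_{[0,t]} x dρ + 2F - F²,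
so it is equivalent to `IntegralEq`: ∫_{[0,t]} x dρ = F(t)² (`solvesRDE_iff`). Bounding x by t gives
F(t) ≤ t. Both sides scale by t⁻² under Γ_t, and F(t) ≤ t makes the remaining mass at ∞ nonnegative,
which proves (a).

For uniqueness in (b), comparing F² with F(s-)² turns F(s) ≥ s/2 into criticality, s ≤ F(s) + F(s-)
for s ∈ Ξ. If F and G are two solutions carried by Ξ ∪ {∞} and critical on Ξ up to an error ε, then
F² + G² is at most ∫(G + G₋)dF + ∫(F + F₋)dG + ε(F + G), and integration by parts turns the two
integrals into 2FG. Hence (F - G)² ≤ 2ε (`IntegralEq.sub_sq_le`); ε = 0 is uniqueness.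

For existence, a finite set is treated by adding atoms from left to right
(`exists_integralEq_finset`). Finite ε-nets of Ξ then give solutions that are critical on Ξ up to ε,
and the same estimate makes their distribution functions uniformly Cauchy. The limit satisfies the
equation because, by Fubini, the equation involves F alone (`integralEq_iff`).

Finally, Γ_t ρ_Ξ inherits the three defining properties for Ξ', so uniqueness identifies it with
ρ_Ξ'. -/

/-! ### Burning times -/

/-- The burning time `s`, for real `s ≤ 1`; it is `∞` if `1 < s`. -/
def burnAt (s : ℝ) : BurnTime :=
  if h : s ≤ 1 then ⟨ENNReal.ofReal s, Or.inl (ENNReal.ofReal_le_one.2 h)⟩ else never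

instance : SecondCountableTopology BurnTime :=
  inferInstanceAs (SecondCountableTopology ({x | x ≤ 1 ∨ x = ⊤} : Set ℝ≥0∞))

theorem coe_burnAt {s : ℝ} (h : s ≤ 1) : (burnAt s : ℝ≥0∞) = ENNReal.ofReal s := by
  simp [burnAt, h]

theorem coe_never : (never : ℝ≥0∞) = ⊤ := rfl

theorem mem_upTo {t : ℝ} {x : BurnTime} : x ∈ upTo t ↔ (x : ℝ≥0∞) ≤ ENNReal.ofReal t := Iff.rfl

theorem never_notMem_upTo (t : ℝ) : never ∉ upTo t := by
  simp [mem_upTo, coe_never]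

theorem measurableSet_upTo (t : ℝ) : MeasurableSet (upTo t) :=
  measurableSet_le (by fun_prop) (by fun_prop)

theorem upTo_mono {s t : ℝ} (h : s ≤ t) : upTo s ⊆ upTo t :=
  fun _ hx => le_trans (mem_upTo.1 hx) (ENNReal.ofReal_le_ofReal h)

theorem exists_eq_burnAt {x : BurnTime} (hx : x ≠ never) : ∃ s ∈ Icc (0 : ℝ) 1, x = burnAt s := by
  have h1 : (x : ℝ≥0∞) ≤ 1 := x.2.resolve_right fun h => hx (Subtype.ext h)
  have h2 : (x : ℝ≥0∞) ≠ ⊤ := ne_top_of_le_ne_top ENNReal.one_ne_top h1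
  have h3 : (x : ℝ≥0∞).toReal ≤ 1 := ENNReal.toReal_le_of_le_ofReal zero_le_one (by simpa using h1)
  refine ⟨(x : ℝ≥0∞).toReal, ⟨ENNReal.toReal_nonneg, h3⟩, Subtype.ext ?_⟩
  rw [coe_burnAt h3, ENNReal.ofReal_toReal h2]

theorem upTo_one : upTo 1 = {never}ᶜ := by
  ext x
  constructor
  · rintro hx rfl
    exact never_notMem_upTo 1 hx
  · intro hx
    obtain ⟨s, hs, rfl⟩ := exists_eq_burnAt hx
    rw [mem_upTo, coe_burnAt hs.2]
    exact ENNReal.ofReal_le_ofReal hs.2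

theorem Iic_burnAt {s : ℝ} (h : s ≤ 1) : Iic (burnAt s) = upTo s := by
  ext x
  rw [mem_upTo, ← coe_burnAt h]
  rfl

/-- The projection of a time to `[0,1]`. -/
def clamp (t : ℝ) : ℝ := max 0 (min t 1)

theorem clamp_mem (t : ℝ) : clamp t ∈ Icc (0 : ℝ) 1 :=
  ⟨le_max_left _ _, max_le zero_le_one (min_le_right _ _)⟩

/-- `ENNReal.ofReal` truncates at 0, so for t < 0 the set `upTo t` is {0} and not empty. This lets
identities known on [0,1] be used at every real t. -/
theorem upTo_clamp (t : ℝ) : upTo (clamp t) = upTo t := by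
  ext x
  by_cases hx : x = never
  · subst hx; simp [never_notMem_upTo]
  obtain ⟨s, hs, rfl⟩ := exists_eq_burnAt hx
  rw [mem_upTo, mem_upTo, coe_burnAt hs.2, clamp]
  rcases le_total t 0 with h | h
  · rw [max_eq_left (le_trans (min_le_left _ _) h), ENNReal.ofReal_zero,
      ENNReal.ofReal_eq_zero.2 h]
  · rw [max_eq_right (le_min h zero_le_one), ENNReal.ofReal_le_ofReal_iff h,
      ENNReal.ofReal_le_ofReal_iff (le_min h zero_le_one), le_min_iff, and_iff_left hs.2]

theorem burnAt_mem_upTo {s t : ℝ} (ht : t ∈ Icc (0 : ℝ) 1) : burnAt s ∈ upTo t ↔ s ≤ t := by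
  by_cases h : s ≤ 1
  · rw [mem_upTo, coe_burnAt h, ENNReal.ofReal_le_ofReal_iff ht.1]
  · have : burnAt s = never := by simp [burnAt, h]
    rw [this]
    exact iff_of_false (never_notMem_upTo t) fun h' => h (h'.trans ht.2)

theorem measurable_burnAt : Measurable burnAt := by
  have h : burnAt = fun s : ℝ => (⟨(burnAt s).1, (burnAt s).2⟩ : BurnTime) := rfl
  rw [h]
  refine Measurable.subtype_mk ?_
  have h2 : (fun s : ℝ => (burnAt s).1) = fun s : ℝ =>
      if s ≤ 1 then ENNReal.ofReal s else ⊤ := by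
    funext s
    unfold burnAt never
    split_ifs <;> rfl
  rw [h2]
  exact Measurable.ite measurableSet_Iic (by fun_prop) (by fun_prop)

/-- Traces of the rays of [0,∞] determine a finite measure; the total mass accounts for the point ∞.
-/
theorem ext_of_upTo {μ ν : Measure BurnTime} [IsFiniteMeasure μ]
    (h : ∀ t ∈ Icc (0 : ℝ) 1, μ (upTo t) = ν (upTo t)) (huniv : μ univ = ν univ) : μ = ν := by
  have hS : MeasurableSet {x : ℝ≥0∞ | x ≤ 1 ∨ x = ⊤} :=
    measurableSet_Iic.union (measurableSet_singleton _)
  have he : MeasurableEmbedding ((↑) : BurnTime → ℝ≥0∞) := MeasurableEmbedding.subtype_coe hS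
  have key : μ.map ((↑) : BurnTime → ℝ≥0∞) = ν.map ((↑) : BurnTime → ℝ≥0∞) := by
    refine Measure.ext_of_Iic _ _ fun a => ?_
    rw [he.map_apply, he.map_apply]
    by_cases ha : a = ⊤
    · simp [ha, huniv]
    · have : ((↑) : BurnTime → ℝ≥0∞) ⁻¹' Iic a = upTo a.toReal := by
        ext x
        simp [mem_upTo, ENNReal.ofReal_toReal ha]
      rw [this, ← upTo_clamp]
      exact h _ (clamp_mem _)
  rw [← he.comap_map μ, ← he.comap_map ν, key]

/-! ### The integral form of the equation -/

/-- The integral equation `∫_{[0,t]} x μ(dx) = μ([0,t])²` for `0 ≤ t ≤ 1`. -/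
def IntegralEq (μ : Measure BurnTime) : Prop :=
  ∀ t ∈ Icc (0 : ℝ) 1, ∫⁻ x in upTo t, (x : ℝ≥0∞) ∂μ = μ (upTo t) ^ 2

/-- Source of the weight x in the integral equation: a finite time x passes the test τ < x with
probability x. At ∞ the probability would be 1. -/
theorem volume_lt_burnTime {x : BurnTime} (hx : x ≠ never) :
    (volume : Measure unitInterval) {τ | ENNReal.ofReal (τ : ℝ) < (x : ℝ≥0∞)} = x := by
  obtain ⟨s, hs, rfl⟩ := exists_eq_burnAt hx
  have : {τ : unitInterval | ENNReal.ofReal (τ : ℝ) < (burnAt s : ℝ≥0∞)} = Iio ⟨s, hs⟩ := by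
    ext τ
    simp only [mem_ofPred_eq, mem_Iio, coe_burnAt hs.2]
    rw [ENNReal.ofReal_lt_ofReal_iff_of_nonneg τ.2.1]
    rfl
  rw [this, coe_burnAt hs.2, unitInterval.volume_Iio]

instance : IsProbabilityMeasure omegaLaw := by
  unfold omegaLaw
  have : IsProbabilityMeasure
      ((2 : ℝ≥0∞)⁻¹ • Measure.dirac 1 + (2 : ℝ≥0∞)⁻¹ • Measure.dirac 2 : Measure ℕ) :=
    ⟨by simp [ENNReal.inv_two_add_inv_two]⟩
  infer_instance

instance (ρ : ProbabilityMeasure BurnTime) : IsProbabilityMeasure (rdeMap ρ) :=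
  Measure.isProbabilityMeasure_map measurable_chi.aemeasurable

theorem omegaLaw_prod_apply {β : Type*} [MeasurableSpace β] (m : Measure β) [SFinite m]
    {S : Set ((unitInterval × ℕ) × β)} (hS : MeasurableSet S) :
    omegaLaw.prod m S =
      (2 : ℝ≥0∞)⁻¹ * ∫⁻ b, (volume : Measure unitInterval) {τ | ((τ, 1), b) ∈ S} ∂m +
      (2 : ℝ≥0∞)⁻¹ * ∫⁻ b, (volume : Measure unitInterval) {τ | ((τ, 2), b) ∈ S} ∂m := by
  have key : ∀ b, omegaLaw ((fun ω => (ω, b)) ⁻¹' S) =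
      (2 : ℝ≥0∞)⁻¹ * (volume : Measure unitInterval) {τ | ((τ, 1), b) ∈ S} +
      (2 : ℝ≥0∞)⁻¹ * (volume : Measure unitInterval) {τ | ((τ, 2), b) ∈ S} := by
    intro b
    have hb : MeasurableSet ((fun ω : unitInterval × ℕ => (ω, b)) ⁻¹' S) :=
      measurable_prodMk_right hS
    rw [omegaLaw, Measure.prod_apply_symm hb, lintegral_add_measure, lintegral_smul_measure,
      lintegral_smul_measure, lintegral_dirac, lintegral_dirac]
    rfl
  have hm : ∀ k : ℕ, Measurable fun b => (volume : Measure unitInterval) {τ | ((τ, k), b) ∈ S} := by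
    intro k
    have : MeasurableSet {p : unitInterval × β | ((p.1, k), p.2) ∈ S} :=
      (by fun_prop : Measurable fun p : unitInterval × β => ((p.1, k), p.2)) hS
    exact measurable_measure_prodMk_right this
  rw [Measure.prod_apply_symm hS]
  simp_rw [key]
  rw [lintegral_add_left ((hm 1).const_mul _), lintegral_const_mul _ (hm 1),
    lintegral_const_mul _ (hm 2)]

/-- For κ = 1 the first argument must lie in [0,t] and exceed τ. For κ = 2 the event x ∧ y ≤ t is
the disjoint union of x ≤ t and (x > t, y ≤ t). -/
theorem rdeMap_upTo (ρ : ProbabilityMeasure BurnTime) (t : ℝ) :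
    rdeMap ρ (upTo t) =
      (2 : ℝ≥0∞)⁻¹ * ∫⁻ x in upTo t, (x : ℝ≥0∞) ∂(ρ : Measure BurnTime) +
      (2 : ℝ≥0∞)⁻¹ * ((ρ : Measure BurnTime) (upTo t)
        + (ρ : Measure BurnTime) (upTo t) * (ρ : Measure BurnTime) (upTo t)ᶜ) := by
  have hU := measurableSet_upTo t
  rw [rdeMap, Measure.map_apply measurable_chi hU,
    omegaLaw_prod_apply _ (measurable_chi hU)]
  congr 2
  · have : ∀ b : BurnTime × BurnTime, (volume : Measure unitInterval)
        {τ | ((τ, 1), b) ∈ (fun p : (unitInterval × ℕ) × (BurnTime × BurnTime) =>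
          chi p.1.1 p.1.2 p.2.1 p.2.2) ⁻¹' upTo t} =
        (upTo t).indicator (fun x : BurnTime => (x : ℝ≥0∞)) b.1 := by
      rintro ⟨x, y⟩
      by_cases hx : x ∈ upTo t
      · rw [indicator_of_mem hx]
        have hn : x ≠ never := fun h => never_notMem_upTo t (h ▸ hx)
        rw [← volume_lt_burnTime hn]
        congr 1
        ext τ
        simp only [mem_preimage, chi, mem_ofPred_eq, if_true]
        split_ifs with h
        · exact iff_of_true hx h
        · exact iff_of_false (never_notMem_upTo t) h
      · rw [indicator_of_notMem hx]
        convert measure_empty (μ := (volume : Measure unitInterval))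
        ext τ
        simp only [mem_preimage, chi, mem_ofPred_eq, if_true, mem_empty_iff_false, iff_false]
        split_ifs with h
        · exact hx
        · exact never_notMem_upTo t
    simp_rw [this]
    rw [lintegral_prod _ (by fun_prop (disch := exact hU))]
    simp only [lintegral_const, measure_univ, mul_one]
    rw [lintegral_indicator hU]
  · have : ∀ b : BurnTime × BurnTime, (volume : Measure unitInterval)
        {τ | ((τ, 2), b) ∈ (fun p : (unitInterval × ℕ) × (BurnTime × BurnTime) =>
          chi p.1.1 p.1.2 p.2.1 p.2.2) ⁻¹' upTo t} =
        ((upTo t ×ˢ univ) ∪ ((upTo t)ᶜ ×ˢ upTo t)).indicator 1 b := by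
      rintro ⟨x, y⟩
      have hmin : min x y ∈ upTo t ↔
          (x, y) ∈ (upTo t ×ˢ univ) ∪ ((upTo t)ᶜ ×ˢ upTo t) := by
        have : min x y ∈ upTo t ↔ x ∈ upTo t ∨ y ∈ upTo t := by
          rcases le_total x y with h | h
          · rw [min_eq_left h]
            exact ⟨Or.inl, fun h' => h'.elim id fun h' => le_trans (show x.1 ≤ y.1 from h) h'⟩
          · rw [min_eq_right h]
            exact ⟨Or.inr, fun h' => h'.elim (fun h' => le_trans (show y.1 ≤ x.1 from h) h') id⟩
        rw [this]
        simp only [mem_union, mem_prod, mem_univ, and_true, mem_compl_iff]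
        tauto
      simp only [mem_preimage, chi, OfNat.ofNat_ne_one, if_false, hmin]
      by_cases h : (x, y) ∈ (upTo t ×ˢ univ) ∪ ((upTo t)ᶜ ×ˢ upTo t)
      · simp only [h, indicator_of_mem, ofPred_true, measure_univ, Pi.one_apply]
      · simp only [h, indicator_of_notMem, ofPred_false, measure_empty, not_false_eq_true]
    simp_rw [this]
    rw [lintegral_indicator_one ((hU.prod .univ).union (hU.compl.prod hU)), measure_union
      (by
        rw [Set.disjoint_left]
        rintro ⟨x, y⟩ h h'
        exact h'.1 h.1) (hU.compl.prod hU), Measure.prod_prod, Measure.prod_prod, measure_univ,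
      mul_one, mul_comm]

theorem rdeMap_upTo_eq_iff (ρ : ProbabilityMeasure BurnTime) (t : ℝ) :
    rdeMap ρ (upTo t) = (ρ : Measure BurnTime) (upTo t) ↔
      ∫⁻ x in upTo t, (x : ℝ≥0∞) ∂(ρ : Measure BurnTime) = (ρ : Measure BurnTime) (upTo t) ^ 2 := by
  rw [rdeMap_upTo, ← mul_add]
  have h1 : (ρ : Measure BurnTime) (upTo t) + (ρ : Measure BurnTime) (upTo t)ᶜ = 1 :=
    prob_add_prob_compl (measurableSet_upTo t)
  have hf : (ρ : Measure BurnTime) (upTo t) ≠ ⊤ := measure_ne_top _ _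
  have hc : (ρ : Measure BurnTime) (upTo t)ᶜ ≠ ⊤ := measure_ne_top _ _
  generalize (ρ : Measure BurnTime) (upTo t) = F at *
  generalize (ρ : Measure BurnTime) (upTo t)ᶜ = C at *
  generalize ∫⁻ x in upTo t, (x : ℝ≥0∞) ∂(ρ : Measure BurnTime) = J
  -- Additive form of 1 - (1 - F)² = 2F - F², free of truncated subtraction.
  have e1 : F + F * C + F ^ 2 = 2 * F := by
    calc F + F * C + F ^ 2 = F + F * (F + C) := by ring
      _ = 2 * F := by rw [h1]; ring
  have hfin : F + F * C ≠ ⊤ := ENNReal.add_ne_top.2 ⟨hf, ENNReal.mul_ne_top hf hc⟩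
  have h2 : (2 : ℝ≥0∞)⁻¹ * (J + (F + F * C)) = F ↔ J + (F + F * C) = 2 * F := by
    rw [← ENNReal.div_eq_inv_mul, eq_comm, ENNReal.eq_div_iff two_ne_zero ENNReal.ofNat_ne_top,
      eq_comm]
  rw [h2, ← e1, add_comm, ENNReal.add_right_inj hfin]

theorem solvesRDE_iff (ρ : ProbabilityMeasure BurnTime) :
    SolvesRDE ρ ↔ IntegralEq (ρ : Measure BurnTime) := by
  constructor
  · intro h t _
    rw [← rdeMap_upTo_eq_iff, h]
  · intro h
    refine ext_of_upTo (fun t ht => (rdeMap_upTo_eq_iff ρ t).2 (h t ht)) ?_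
    rw [measure_univ, measure_univ]

theorem IntegralEq.upTo_le {μ : Measure BurnTime} [IsFiniteMeasure μ] (h : IntegralEq μ) {t : ℝ}
    (ht : t ∈ Icc (0 : ℝ) 1) : μ (upTo t) ≤ ENNReal.ofReal t := by
  have h1 : μ (upTo t) ^ 2 ≤ ENNReal.ofReal t * μ (upTo t) := by
    rw [← h t ht, ← setLIntegral_const]
    exact setLIntegral_mono measurable_const fun x hx => hx
  by_cases h0 : μ (upTo t) = 0
  · simp [h0]
  rw [sq] at h1
  exact (ENNReal.mul_le_mul_iff_left h0 (measure_ne_top _ _)).1 h1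

theorem IntegralEq.upTo_le_one {μ : Measure BurnTime} [IsFiniteMeasure μ] (h : IntegralEq μ)
    (t : ℝ) : μ (upTo t) ≤ 1 := by
  rw [← upTo_clamp]
  exact (h.upTo_le (clamp_mem t)).trans (ENNReal.ofReal_le_one.2 (clamp_mem t).2)

/-- A finite solution of the integral equation without mass at `∞` is completed to a solution
of the recursive distributional equation by an atom at `∞`. -/
theorem IntegralEq.exists_completion {μ : Measure BurnTime} [IsFiniteMeasure μ]
    (h : IntegralEq μ) (h0 : μ {never} = 0) :
    ∃ ρ : ProbabilityMeasure BurnTime, SolvesRDE ρ ∧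
      (ρ : Measure BurnTime) = μ + (1 - μ univ) • Measure.dirac never ∧
      ∀ t, (ρ : Measure BurnTime) (upTo t) = μ (upTo t) := by
  have hu : μ univ ≤ 1 := by
    rw [← measure_add_measure_compl (measurableSet_singleton never), h0, zero_add, ← upTo_one]
    exact h.upTo_le_one 1
  have hp : IsProbabilityMeasure (μ + (1 - μ univ) • Measure.dirac never) :=
    ⟨by simp [add_tsub_cancel_of_le hu]⟩
  have hv : ∀ t, (μ + (1 - μ univ) • Measure.dirac never) (upTo t) = μ (upTo t) := by
    intro t
    simp [never_notMem_upTo, Measure.dirac_apply' _ (measurableSet_upTo t)]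
  refine ⟨⟨_, hp⟩, (solvesRDE_iff _).2 fun t ht => ?_, rfl, hv⟩
  change ∫⁻ x in upTo t, (x : ℝ≥0∞) ∂(μ + (1 - μ univ) • Measure.dirac never) =
    ((μ + (1 - μ univ) • Measure.dirac never) (upTo t)) ^ 2
  rw [hv, ← h t ht, Measure.restrict_add, Measure.restrict_smul,
    Measure.restrict_eq_zero.2 (show Measure.dirac never (upTo t) = 0 by
      simp [never_notMem_upTo, Measure.dirac_apply' _ (measurableSet_upTo t)])]
  simp

/-! ### Scaling -/

theorem psi_mem_upTo {t s : ℝ} (ht : 0 < t) (hs : s ∈ Icc (0 : ℝ) 1) {y : BurnTime} :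
    psi t y ∈ upTo s ↔ y ∈ upTo (t * s) := by
  have hle : t * s ≤ t := by nlinarith [hs.1, hs.2]
  unfold psi
  split_ifs with h
  · rw [mem_upTo, mem_upTo, ENNReal.div_le_iff (by simpa using ht) ENNReal.ofReal_ne_top,
      ENNReal.ofReal_mul ht.le, mul_comm]
  · exact iff_of_false (never_notMem_upTo s) fun h' => h (upTo_mono hle h')

theorem coe_psi {t : ℝ} {y : BurnTime} (hy : y ∈ upTo t) :
    (psi t y : ℝ≥0∞) = (y : ℝ≥0∞) / ENNReal.ofReal t := by
  rw [psi, dif_pos (mem_upTo.1 hy)]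

/-- The part of `Γ_t ρ` on `[0,1]`. -/
def scaled (t : ℝ) (ρ : Measure BurnTime) : Measure BurnTime :=
  (ENNReal.ofReal t)⁻¹ • Measure.map (psi t) (ρ.restrict (upTo t))

theorem isFiniteMeasure_scaled {t : ℝ} (ht : 0 < t) (ρ : Measure BurnTime) [IsFiniteMeasure ρ] :
    IsFiniteMeasure (scaled t ρ) := by
  refine ⟨?_⟩
  rw [scaled, Measure.smul_apply, smul_eq_mul]
  exact ENNReal.mul_lt_top (ENNReal.inv_lt_top.2 (by simpa using ht)) (measure_lt_top _ _)

theorem scaled_univ (t : ℝ) (ρ : Measure BurnTime) :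
    scaled t ρ univ = (ENNReal.ofReal t)⁻¹ * ρ (upTo t) := by
  rw [scaled, Measure.smul_apply, smul_eq_mul, Measure.map_apply (measurable_psi t) .univ]
  simp

theorem scaled_never (t : ℝ) (ρ : Measure BurnTime) : scaled t ρ {never} = 0 := by
  rw [scaled, Measure.smul_apply, smul_eq_mul,
    Measure.map_apply (measurable_psi t) (measurableSet_singleton _),
    Measure.restrict_apply (measurable_psi t (measurableSet_singleton _))]
  convert mul_zero _
  convert measure_empty (μ := ρ)
  ext y
  simp only [mem_inter_iff, mem_preimage, mem_singleton_iff, mem_empty_iff_false, iff_false, not_and]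
  intro h hy
  rw [psi, dif_pos (mem_upTo.1 hy)] at h
  have h1 := congrArg Subtype.val h
  simp only [coe_never, ENNReal.div_eq_top] at h1
  -- A quotient is ∞ only for a nonzero numerator over 0, excluded by y ≤ `ENNReal.ofReal t`, or for
  -- an infinite numerator. No sign of t is needed, as 0/0 = 0.
  rcases h1 with h1 | h1
  · rw [mem_upTo, h1.2] at hy
    exact h1.1 (by simpa using hy)
  · exact (ne_top_of_le_ne_top ENNReal.ofReal_ne_top (mem_upTo.1 hy)) h1.1

theorem psi_preimage_inter {t s : ℝ} (ht : 0 < t) (hs : s ∈ Icc (0 : ℝ) 1) :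
    psi t ⁻¹' upTo s ∩ upTo t = upTo (t * s) := by
  ext y
  rw [mem_inter_iff, mem_preimage, psi_mem_upTo ht hs]
  exact and_iff_left_of_imp fun h => upTo_mono (by nlinarith [hs.1, hs.2]) h

theorem scaled_upTo {t s : ℝ} (ht : 0 < t) (hs : s ∈ Icc (0 : ℝ) 1) (ρ : Measure BurnTime) :
    scaled t ρ (upTo s) = (ENNReal.ofReal t)⁻¹ * ρ (upTo (t * s)) := by
  rw [scaled, Measure.smul_apply, smul_eq_mul,
    Measure.map_apply (measurable_psi t) (measurableSet_upTo s),
    Measure.restrict_apply (measurable_psi t (measurableSet_upTo s)), psi_preimage_inter ht hs]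

theorem IntegralEq.lintegral_upTo {μ : Measure BurnTime} (h : IntegralEq μ) (t : ℝ) :
    ∫⁻ x in upTo t, (x : ℝ≥0∞) ∂μ = μ (upTo t) ^ 2 := by
  rw [← upTo_clamp]
  exact h _ (clamp_mem t)

/-- The equation is homogeneous: the left side gains one factor t⁻¹ from the measure and one from
the integrand, the right side gains t⁻¹ squared. -/
theorem integralEq_scaled {ρ : Measure BurnTime} (h : IntegralEq ρ) {t : ℝ} (ht : 0 < t) :
    IntegralEq (scaled t ρ) := by
  intro s hs
  have hU := measurableSet_upTo (t * s)
  rw [scaled_upTo ht hs, scaled, Measure.restrict_smul, lintegral_smul_measure,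
    Measure.restrict_map (measurable_psi t) (measurableSet_upTo s),
    lintegral_map (by fun_prop) (measurable_psi t),
    Measure.restrict_restrict (measurable_psi t (measurableSet_upTo s)),
    psi_preimage_inter ht hs, smul_eq_mul]
  have : ∫⁻ y in upTo (t * s), (psi t y : ℝ≥0∞) ∂ρ =
      (ENNReal.ofReal t)⁻¹ * ∫⁻ y in upTo (t * s), (y : ℝ≥0∞) ∂ρ := by
    rw [← lintegral_const_mul _ (by fun_prop)]
    refine setLIntegral_congr_fun hU fun y hy => ?_
    rw [coe_psi (upTo_mono (by nlinarith [hs.1, hs.2]) hy), ENNReal.div_eq_inv_mul]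
  rw [this, h.lintegral_upTo, mul_pow, ← mul_assoc, sq (ENNReal.ofReal t)⁻¹]

/-- Points beyond t are sent to ∞, so the coefficient of the atom there is t⁻¹(1 - F(t)) + 1 - t⁻¹ =
1 - t⁻¹F(t), which `hle` makes nonnegative. -/
theorem Gamma_eq {ρ ν : ProbabilityMeasure BurnTime} {t : ℝ} (ht : 0 < t)
    (hle : (ENNReal.ofReal t)⁻¹ * (ρ : Measure BurnTime) (upTo t) ≤ 1)
    (hν : (ν : Measure BurnTime) = scaled t ρ + (1 - scaled t ρ univ) • Measure.dirac never) :
    (ν : Measure BurnTime).toSignedMeasure = Gamma t ρ := by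
  ext S hS
  have hU := measurableSet_upTo t
  have hsplit : Measure.map (psi t) (ρ : Measure BurnTime) S =
      Measure.map (psi t) ((ρ : Measure BurnTime).restrict (upTo t)) S +
        (ρ : Measure BurnTime) (upTo t)ᶜ * Measure.dirac never S := by
    conv_lhs => rw [← Measure.restrict_add_restrict_compl (μ := (ρ : Measure BurnTime)) hU]
    rw [Measure.map_add _ _ (measurable_psi t), Measure.add_apply]
    congr 1
    have : Measure.map (psi t) ((ρ : Measure BurnTime).restrict (upTo t)ᶜ) =
        Measure.map (fun _ => never) ((ρ : Measure BurnTime).restrict (upTo t)ᶜ) := by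
      refine Measure.map_congr ?_
      filter_upwards [ae_restrict_mem hU.compl] with y hy
      exact dif_neg hy
    rw [this, Measure.map_const]
    simp
  have hr := congrArg ENNReal.toReal hsplit
  have hc : (ρ : Measure BurnTime) (upTo t)ᶜ = 1 - (ρ : Measure BurnTime) (upTo t) :=
    prob_compl_eq_one_sub hU
  rw [ENNReal.toReal_add (measure_ne_top _ _)
    (ENNReal.mul_ne_top (measure_ne_top _ _) (measure_ne_top _ _)), ENNReal.toReal_mul, hc,
    ENNReal.toReal_sub_of_le prob_le_one ENNReal.one_ne_top] at hr
  have hl := congrArg (fun m : Measure BurnTime => (m S).toReal) hν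
  have := isFiniteMeasure_scaled ht (ρ : Measure BurnTime)
  simp only [Measure.add_apply, Measure.smul_apply, smul_eq_mul] at hl
  rw [scaled_univ, ENNReal.toReal_add (measure_ne_top _ _)
    (ENNReal.mul_ne_top (ne_top_of_le_ne_top ENNReal.one_ne_top tsub_le_self)
      (measure_ne_top _ _)), ENNReal.toReal_mul, ENNReal.toReal_sub_of_le hle ENNReal.one_ne_top,
    ENNReal.toReal_mul, ENNReal.toReal_inv, ENNReal.toReal_ofReal ht.le, scaled,
    Measure.smul_apply, smul_eq_mul, ENNReal.toReal_mul, ENNReal.toReal_inv,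
    ENNReal.toReal_ofReal ht.le] at hl
  simp only [Gamma, add_apply, smul_apply, smul_eq_mul,
    Measure.toSignedMeasure_apply_measurable hS, Measure.real]
  rw [hl, hr]
  simp only [ENNReal.toReal_one]
  ring

/-- `Γ_t ρ` is a probability measure that solves the equation whenever `ρ` does. -/
theorem exists_Gamma {ρ : ProbabilityMeasure BurnTime} (h : SolvesRDE ρ) {t : ℝ} (ht : 0 < t) :
    ∃ ν : ProbabilityMeasure BurnTime, SolvesRDE ν ∧
      (ν : Measure BurnTime).toSignedMeasure = Gamma t ρ ∧
      (ν : Measure BurnTime) = scaled t ρ + (1 - scaled t ρ univ) • Measure.dirac never ∧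
      ∀ s ∈ Icc (0 : ℝ) 1,
        (ν : Measure BurnTime) (upTo s) =
          (ENNReal.ofReal t)⁻¹ * (ρ : Measure BurnTime) (upTo (t * s)) := by
  have hI := (solvesRDE_iff ρ).1 h
  have := isFiniteMeasure_scaled ht (ρ : Measure BurnTime)
  obtain ⟨ν, h1, h2, h3⟩ := (integralEq_scaled hI ht).exists_completion (scaled_never t ρ)
  refine ⟨ν, h1, Gamma_eq ht ?_ h2, h2, fun s hs => (h3 s).trans (scaled_upTo ht hs ρ)⟩
  simpa only [scaled_upTo ht ⟨zero_le_one, le_rfl⟩, mul_one] using (integralEq_scaled hI ht).upTo_le_one 1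

/-! ### Comparison of solutions -/

/-- Integration by parts for the distribution functions of two measures. -/
theorem measure_Iic_mul_measure_Iic {α : Type*} [LinearOrder α] [TopologicalSpace α]
    [OrderClosedTopology α] [SecondCountableTopology α] [MeasurableSpace α] [BorelSpace α]
    (μ ν : Measure α) [SFinite μ] [SFinite ν] (t : α) :
    μ (Iic t) * ν (Iic t) = ∫⁻ x in Iic t, ν (Iic x) ∂μ + ∫⁻ x in Iic t, μ (Iio x) ∂ν := by
  have hA : MeasurableSet {p : α × α | p.2 ≤ p.1 ∧ p.1 ≤ t} :=
    (measurableSet_le measurable_snd measurable_fst).inter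
      (measurableSet_le measurable_fst measurable_const)
  have hB : MeasurableSet {p : α × α | p.1 < p.2 ∧ p.2 ≤ t} :=
    (measurableSet_lt measurable_fst measurable_snd).inter
      (measurableSet_le measurable_snd measurable_const)
  -- The square is cut along the diagonal. The diagonal goes to the first piece, hence `Iic` in one
  -- integral and `Iio` in the other.
  have hU : Iic t ×ˢ Iic t = {p : α × α | p.2 ≤ p.1 ∧ p.1 ≤ t} ∪ {p | p.1 < p.2 ∧ p.2 ≤ t} := by
    ext ⟨x, y⟩
    simp only [mem_prod, mem_Iic, mem_union, mem_ofPred_eq]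
    grind
  have hd : Disjoint {p : α × α | p.2 ≤ p.1 ∧ p.1 ≤ t} {p | p.1 < p.2 ∧ p.2 ≤ t} := by
    rw [Set.disjoint_left]
    rintro p h h'
    exact absurd h.1 (not_le.2 h'.1)
  rw [← Measure.prod_prod, hU, measure_union hd hB]
  congr 1
  · rw [Measure.prod_apply hA, ← lintegral_indicator measurableSet_Iic]
    congr 1
    ext x
    by_cases hx : x ≤ t
    · rw [indicator_of_mem (mem_Iic.2 hx)]
      congr 1
      ext y
      simp [hx]
    · rw [indicator_of_notMem (by simpa using hx)]
      convert measure_empty (μ := ν)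
      ext y
      simp [hx]
  · rw [Measure.prod_apply_symm hB, ← lintegral_indicator measurableSet_Iic]
    congr 1
    ext x
    by_cases hx : x ≤ t
    · rw [indicator_of_mem (mem_Iic.2 hx)]
      congr 1
      ext y
      simp [hx]
    · rw [indicator_of_notMem (by simpa using hx)]
      convert measure_empty (μ := μ)
      ext y
      simp [hx]

/-- Replacing w by its upper bounds leaves four integrals, which pair up into the two integrations
by parts of the same product, one for each order of the measures. -/
theorem sq_add_sq_le {α : Type*} [LinearOrder α] [TopologicalSpace α]
    [OrderClosedTopology α] [SecondCountableTopology α] [MeasurableSpace α] [BorelSpace α]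
    {μ ν : Measure α} [SFinite μ] [SFinite ν] {w : α → ℝ≥0∞} {t : α} {ε : ℝ≥0∞}
    (hμ : ∫⁻ x in Iic t, w x ∂μ = μ (Iic t) ^ 2) (hν : ∫⁻ x in Iic t, w x ∂ν = ν (Iic t) ^ 2)
    (hμν : ∀ᵐ x ∂μ.restrict (Iic t), w x ≤ ν (Iic x) + ν (Iio x) + ε)
    (hνμ : ∀ᵐ x ∂ν.restrict (Iic t), w x ≤ μ (Iic x) + μ (Iio x) + ε) :
    μ (Iic t) ^ 2 + ν (Iic t) ^ 2 ≤
      2 * (μ (Iic t) * ν (Iic t)) + ε * (μ (Iic t) + ν (Iic t)) := by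
  have hmc : ∀ m : Measure α, Measurable fun x => m (Iic x) := fun m =>
    (show Monotone fun x => m (Iic x) from fun x y h => measure_mono (Iic_subset_Iic.2 h)).measurable
  have hmo : ∀ m : Measure α, Measurable fun x => m (Iio x) := fun m =>
    (show Monotone fun x => m (Iio x) from fun x y h => measure_mono (Iio_subset_Iio h)).measurable
  have h1 := lintegral_mono_ae hμν
  have h2 := lintegral_mono_ae hνμ
  rw [hμ, lintegral_add_right _ measurable_const, lintegral_add_right _ (hmo ν),
    setLIntegral_const] at h1
  rw [hν, lintegral_add_right _ measurable_const, lintegral_add_right _ (hmo μ),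
    setLIntegral_const] at h2
  have e1 := measure_Iic_mul_measure_Iic μ ν t
  have e2 := measure_Iic_mul_measure_Iic ν μ t
  refine (add_le_add h1 h2).trans (le_of_eq ?_)
  rw [two_mul]
  nth_rw 2 [mul_comm (μ (Iic t))]
  rw [e1, e2]
  ring

/-- If `μ([0,s]) ≥ s/2`, then `μ([0,s]) + μ([0,s)) ≥ s`. -/
theorem IntegralEq.le_Iic_add_Iio {μ : Measure BurnTime} [IsFiniteMeasure μ] (h : IntegralEq μ)
    {s : ℝ} (hs : s ∈ Ioc (0 : ℝ) 1) (hs2 : ENNReal.ofReal (s / 2) ≤ μ (upTo s)) :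
    ENNReal.ofReal s ≤ μ (Iic (burnAt s)) + μ (Iio (burnAt s)) := by
  have hIo : MeasurableSet (Iio (burnAt s)) := measurableSet_Iio
  have hle : μ (Iio (burnAt s)) ^ 2 ≤ ∫⁻ x in Iio (burnAt s), (x : ℝ≥0∞) ∂μ := by
    obtain ⟨u, hu, hus, hlim⟩ := exists_seq_strictMono_tendsto s
    have hU : ⋃ n, upTo (u n) = Iio (burnAt s) := by
      ext x
      rw [mem_iUnion, mem_Iio]
      constructor
      · rintro ⟨n, hn⟩
        change (x : ℝ≥0∞) < burnAt s
        refine lt_of_le_of_lt (mem_upTo.1 hn) ?_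
        rw [coe_burnAt hs.2]
        exact (ENNReal.ofReal_lt_ofReal_iff hs.1).2 (hus n)
      · intro hx
        have hne : x ≠ never := by
          rintro rfl
          exact not_top_lt (show (⊤ : ℝ≥0∞) < (burnAt s : ℝ≥0∞) from hx)
        obtain ⟨r, hr, rfl⟩ := exists_eq_burnAt hne
        have hrs : r < s := by
          have : (burnAt r : ℝ≥0∞) < (burnAt s : ℝ≥0∞) := hx
          rwa [coe_burnAt hr.2, coe_burnAt hs.2,
            ENNReal.ofReal_lt_ofReal_iff_of_nonneg hr.1] at this
        obtain ⟨n, hn⟩ := (hlim.eventually (lt_mem_nhds hrs)).exists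
        refine ⟨n, ?_⟩
        rw [mem_upTo, coe_burnAt hr.2]
        exact ENNReal.ofReal_le_ofReal hn.le
    have hmono : Monotone fun n => upTo (u n) :=
      fun m n hmn => upTo_mono (hu.monotone hmn)
    have ht := tendsto_measure_iUnion_atTop (μ := μ) hmono
    rw [hU] at ht
    refine le_of_tendsto' (ENNReal.Tendsto.pow (n := 2) ht) fun n => ?_
    simp only [Function.comp]
    rw [← h.lintegral_upTo]
    refine lintegral_mono_set ?_
    rw [← hU]
    exact subset_iUnion (fun n => upTo (u n)) n
  have hsplit : Iic (burnAt s) = Iio (burnAt s) ∪ {burnAt s} := Iio_union_right.symm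
  have hdisj : Disjoint (Iio (burnAt s)) {burnAt s} := by simp
  have hF : μ (Iic (burnAt s)) = μ (Iio (burnAt s)) + μ {burnAt s} := by
    rw [hsplit, measure_union hdisj (measurableSet_singleton _)]
  have hI := h.lintegral_upTo s
  rw [← Iic_burnAt hs.2] at hI hs2
  rw [hF, hsplit, lintegral_union (measurableSet_singleton _) hdisj,
    lintegral_singleton, coe_burnAt hs.2] at hI
  -- With a = μ([0,s)) and d the atom at s, this says s·d ≤ (2a + d)·d.
  have hle' : μ (Iio (burnAt s)) ^ 2 + ENNReal.ofReal s * μ {burnAt s} ≤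
      (μ (Iio (burnAt s)) + μ {burnAt s}) ^ 2 := by
    rw [← hI]
    gcongr
  rw [hF] at hs2 ⊢
  have hfa : μ (Iio (burnAt s)) ≠ ⊤ := measure_ne_top _ _
  have hfd : μ {burnAt s} ≠ ⊤ := measure_ne_top _ _
  lift μ (Iio (burnAt s)) to NNReal using hfa with a
  lift μ {burnAt s} to NNReal using hfd with d
  have hs0 := hs.1.le
  lift s to NNReal using hs0
  rw [ENNReal.ofReal_coe_nnreal] at *
  have e2 : ENNReal.ofReal ((s : ℝ) / 2) = ((s / 2 : NNReal) : ℝ≥0∞) := by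
    rw [← ENNReal.ofReal_coe_nnreal]; push_cast; rfl
  rw [e2] at hs2
  norm_cast at hs2 hle' ⊢
  rw [← NNReal.coe_le_coe] at hs2 hle' ⊢
  push_cast at hs2 hle' ⊢
  -- Without an atom the half bound is already s ≤ 2a; with one, divide by d.
  rcases eq_or_lt_of_le d.2 with hd | hd
  · change 0 = (d : ℝ) at hd
    linarith
  · change 0 < (d : ℝ) at hd
    have : (s : ℝ) * d ≤ (2 * a + d) * d := by nlinarith
    have := le_of_mul_le_mul_right this hd
    linarith

/-- Two finite solutions are close if each of them almost surely takes values where the other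
one is almost critical. -/
theorem IntegralEq.sub_sq_le {μ ν : Measure BurnTime} [IsFiniteMeasure μ] [IsFiniteMeasure ν]
    (hμ : IntegralEq μ) (hν : IntegralEq ν) {ε : ℝ} (hε : 0 ≤ ε)
    (hμν : ∀ᵐ x ∂μ, x ≠ never → (x : ℝ≥0∞) ≤ ν (Iic x) + ν (Iio x) + ENNReal.ofReal ε)
    (hνμ : ∀ᵐ x ∂ν, x ≠ never → (x : ℝ≥0∞) ≤ μ (Iic x) + μ (Iio x) + ENNReal.ofReal ε) (t : ℝ) :
    (μ.real (upTo t) - ν.real (upTo t)) ^ 2 ≤ 2 * ε := by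
  have ht1 := (clamp_mem t).2
  have hU : upTo t = Iic (burnAt (clamp t)) := by rw [Iic_burnAt ht1, upTo_clamp]
  have hm : ∀ (m : Measure BurnTime) {P : BurnTime → Prop}, (∀ᵐ x ∂m, x ≠ never → P x) →
      ∀ᵐ x ∂m.restrict (Iic (burnAt (clamp t))), P x := by
    intro m P h
    filter_upwards [ae_restrict_of_ae h, ae_restrict_mem measurableSet_Iic] with x hx hxt
    refine hx ?_
    rintro rfl
    rw [← hU] at hxt
    exact never_notMem_upTo t hxt
  have h1 := hμ.lintegral_upTo t
  have h2 := hν.lintegral_upTo t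
  have hμ1 := hμ.upTo_le_one t
  have hν1 := hν.upTo_le_one t
  rw [hU] at h1 h2 hμ1 hν1 ⊢
  have key := sq_add_sq_le h1 h2 (hm μ hμν) (hm ν hνμ)
  unfold Measure.real
  generalize μ (Iic (burnAt (clamp t))) = F at *
  generalize ν (Iic (burnAt (clamp t))) = G at *
  lift F to NNReal using ne_top_of_le_ne_top ENNReal.one_ne_top hμ1
  lift G to NNReal using ne_top_of_le_ne_top ENNReal.one_ne_top hν1
  lift ε to NNReal using hε
  rw [ENNReal.ofReal_coe_nnreal] at key
  norm_cast at key hμ1 hν1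
  rw [← NNReal.coe_le_coe] at key hμ1 hν1
  push_cast at key hμ1 hν1
  simp only [ENNReal.coe_toReal]
  -- (F - G)² ≤ ε(F + G), and both F and G are at most 1.
  nlinarith [ε.2, mul_nonneg ε.2 (sub_nonneg.2 hμ1), mul_nonneg ε.2 (sub_nonneg.2 hν1)]

theorem IsBurningLaw.le_Iic_add_Iio {Ξ : Set ℝ} (hΞ : Ξ ⊆ Ioc 0 1)
    {ρ ρ' : ProbabilityMeasure BurnTime} (h : IsBurningLaw Ξ ρ) (h' : IsBurningLaw Ξ ρ') :
    ∀ᵐ x ∂(ρ : Measure BurnTime), x ≠ never →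
      (x : ℝ≥0∞) ≤ (ρ' : Measure BurnTime) (Iic x) + (ρ' : Measure BurnTime) (Iio x)
        + ENNReal.ofReal 0 := by
  filter_upwards [h.concentrated] with x hx hne
  obtain ⟨s, hs, hxs⟩ := hx.resolve_left hne
  have : x = burnAt s := Subtype.ext (by rw [hxs, coe_burnAt (hΞ hs).2])
  rw [hxs, this, ENNReal.ofReal_zero, add_zero]
  exact ((solvesRDE_iff ρ').1 h'.solves).le_Iic_add_Iio (hΞ hs) (h'.half_le s hs)

theorem IsBurningLaw.unique {Ξ : Set ℝ} (hΞ : Ξ ⊆ Ioc 0 1)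
    {ρ ρ' : ProbabilityMeasure BurnTime} (h : IsBurningLaw Ξ ρ) (h' : IsBurningLaw Ξ ρ') :
    ρ = ρ' := by
  refine Subtype.ext (ext_of_upTo (μ := (ρ : Measure BurnTime)) (ν := (ρ' : Measure BurnTime))
    (fun t _ => ?_) (by rw [measure_univ, measure_univ]))
  have key := ((solvesRDE_iff ρ).1 h.solves).sub_sq_le ((solvesRDE_iff ρ').1 h'.solves) le_rfl
    (h.le_Iic_add_Iio hΞ h') (h'.le_Iic_add_Iio hΞ h) t
  rw [mul_zero] at key
  have := sub_eq_zero.1 (pow_eq_zero_iff two_ne_zero |>.1 (le_antisymm key (sq_nonneg _)))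
  exact (ENNReal.toReal_eq_toReal_iff' (measure_ne_top _ _) (measure_ne_top _ _)).1 this

/-! ### Rescaling of the set of burning times -/

theorem rescale_subset {Ξ : Set ℝ} (hΞ : Ξ ⊆ Ioc 0 1) {t : ℝ} (ht : 0 < t) :
    rescale t Ξ ⊆ Ioc 0 1 := by
  rintro _ ⟨⟨y, hy, rfl⟩, h⟩
  exact ⟨mul_pos (inv_pos.2 ht) (hΞ hy).1, h.2⟩

/-- Ξ may accumulate at 0 without containing it; adjoining (-∞,0] absorbs this and gives a set
closed in ℝ. -/
theorem isRelClosed_iff {Ξ : Set ℝ} :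
    IsRelClosed Ξ ↔ Ξ ⊆ Ioc 0 1 ∧ IsClosed (Ξ ∪ Iic 0) := by
  refine and_congr_right fun hΞ => ⟨fun h => ?_, fun h => ?_⟩
  · obtain ⟨K, hK, hKΞ⟩ := isClosed_induced_iff.1 h
    have : Ξ ∪ Iic 0 = (K ∩ Icc 0 1) ∪ Iic 0 := by
      ext x
      by_cases hx : x ∈ Ioc (0 : ℝ) 1
      · have := Set.ext_iff.1 hKΞ ⟨x, hx⟩
        simp only [mem_preimage] at this
        simp [this, hx.1.le, hx.2]
      · have h1 : x ∉ Ξ := fun h => hx (hΞ h)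
        simp only [mem_union, h1, false_or, mem_inter_iff, mem_Icc, mem_Iic]
        grind
    rw [this]
    exact (hK.inter isClosed_Icc).union isClosed_Iic
  · convert h.preimage (continuous_subtype_val (p := (· ∈ Ioc (0 : ℝ) 1))) using 1
    ext ⟨x, hx⟩
    simp [hx.1]

theorem isRelClosed_rescale {Ξ : Set ℝ} (h : IsRelClosed Ξ) {t : ℝ} (ht : 0 < t) :
    IsRelClosed (rescale t Ξ) := by
  refine ⟨rescale_subset h.1 ht, ?_⟩
  have hc := (isRelClosed_iff.1 h).2
  have hcont : Continuous fun x : Ioc (0 : ℝ) 1 => t * (x : ℝ) := by fun_prop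
  convert hc.preimage hcont using 1
  ext ⟨x, hx⟩
  simp only [rescale, mem_preimage, mem_inter_iff, mem_image, mem_union, mem_Iic,
    mem_Icc, hx.1.le, hx.2, and_true, not_le.2 (mul_pos ht hx.1), or_false]
  constructor
  · rintro ⟨y, hy, rfl⟩
    rwa [mul_inv_cancel_left₀ ht.ne']
  · intro hy
    exact ⟨_, hy, inv_mul_cancel_left₀ ht.ne' x⟩

theorem ae_scaled {ρ : Measure BurnTime} {t : ℝ} {P : BurnTime → Prop}
    (hP : MeasurableSet {x | P x})
    (h : ∀ᵐ y ∂ρ.restrict (upTo t), P (psi t y)) : ∀ᵐ x ∂scaled t ρ, P x :=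
  Measure.ae_smul_measure ((ae_map_iff (measurable_psi t).aemeasurable hP).2 h) _

theorem measurableSet_burnTimes {Ξ : Set ℝ} (h : IsRelClosed Ξ) :
    MeasurableSet {x : BurnTime | x = never ∨ ∃ s ∈ Ξ, (x : ℝ≥0∞) = ENNReal.ofReal s} := by
  have hΞ : MeasurableSet Ξ := by
    have : Ξ = (Ξ ∪ Iic 0) \ Iic 0 := by
      ext x
      simp only [Set.mem_sdiff, mem_union, mem_Iic, not_le]
      exact ⟨fun hx => ⟨Or.inl hx, (h.1 hx).1⟩, fun hx => hx.1.resolve_right (not_le.2 hx.2)⟩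
    rw [this]
    exact (isRelClosed_iff.1 h).2.measurableSet.diff measurableSet_Iic
  have : {x : BurnTime | x = never ∨ ∃ s ∈ Ξ, (x : ℝ≥0∞) = ENNReal.ofReal s} =
      {never} ∪ ((fun x : BurnTime => (x : ℝ≥0∞).toReal) ⁻¹' Ξ ∩ {never}ᶜ) := by
    ext x
    by_cases hx : x = never
    · simp [hx]
    obtain ⟨r, hr, rfl⟩ := exists_eq_burnAt hx
    simp only [mem_ofPred_eq, hx, false_or, mem_union, mem_singleton_iff, mem_inter_iff,
      mem_preimage, mem_compl_iff, not_false_eq_true, and_true, coe_burnAt hr.2,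
      ENNReal.toReal_ofReal hr.1]
    constructor
    · rintro ⟨s, hs, h'⟩
      rwa [(ENNReal.ofReal_eq_ofReal_iff hr.1 (h.1 hs).1.le).1 h']
    · exact fun hr' => ⟨r, hr', rfl⟩
  rw [this]
  exact (measurableSet_singleton _).union
    ((measurable_subtype_coe.ennreal_toReal hΞ).inter (measurableSet_singleton _).compl)

theorem IsBurningLaw.exists_rescale {Ξ : Set ℝ} (hΞ : IsRelClosed Ξ)
    {ρ : ProbabilityMeasure BurnTime} (h : IsBurningLaw Ξ ρ) {t : ℝ} (ht : 0 < t) :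
    ∃ ν : ProbabilityMeasure BurnTime, IsBurningLaw (rescale t Ξ) ν ∧
      (ν : Measure BurnTime).toSignedMeasure = Gamma t ρ := by
  obtain ⟨ν, h1, h2, h3, h4⟩ := exists_Gamma h.solves ht
  refine ⟨ν, ⟨h1, ?_, ?_⟩, h2⟩
  · rw [h3, ae_add_measure_iff]
    constructor
    · refine ae_scaled (measurableSet_burnTimes (isRelClosed_rescale hΞ ht)) ?_
      filter_upwards [ae_restrict_of_ae h.concentrated, ae_restrict_mem (measurableSet_upTo t)]
        with y hy hyt
      have hne : y ≠ never := by
        rintro rfl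
        exact never_notMem_upTo t hyt
      obtain ⟨s, hs, hys⟩ := hy.resolve_left hne
      refine Or.inr ⟨t⁻¹ * s, ⟨⟨s, hs, rfl⟩, ?_⟩, ?_⟩
      · rw [mem_upTo, hys, ENNReal.ofReal_le_ofReal_iff ht.le] at hyt
        refine ⟨(mul_pos (inv_pos.2 ht) (hΞ.1 hs).1).le, ?_⟩
        rwa [inv_mul_le_iff₀ ht, mul_one]
      · rw [coe_psi hyt, hys, ← ENNReal.ofReal_div_of_pos ht, div_eq_inv_mul]
    · refine Measure.ae_smul_measure ?_ _
      rw [ae_dirac_iff (measurableSet_burnTimes (isRelClosed_rescale hΞ ht))]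
      exact Or.inl rfl
  · rintro _ hs
    have hmem := rescale_subset hΞ.1 ht hs
    obtain ⟨⟨y, hy, rfl⟩, -⟩ := hs
    rw [h4 _ ⟨hmem.1.le, hmem.2⟩]
    simp only
    rw [mul_inv_cancel_left₀ ht.ne', mul_div_assoc, ENNReal.ofReal_mul (inv_nonneg.2 ht.le),
      ENNReal.ofReal_inv_of_pos ht]
    exact mul_le_mul_right (h.half_le y hy) _

/-! ### Existence for finite sets -/

/-- Greedy construction: a new largest point a receives an atom only if the mass m so far is below
a/2. An atom d at a preserves the equation iff m² + a·d = (m + d)², that is, d = 0 or d = a - 2m. -/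
theorem exists_integralEq_finset (T : Finset ℝ) (hT : (T : Set ℝ) ⊆ Ioc 0 1) :
    ∃ μ : Measure BurnTime, IsFiniteMeasure μ ∧ IntegralEq μ ∧
      (∀ᵐ x ∂μ, ∃ s ∈ T, x = burnAt s) ∧ ∀ s ∈ T, ENNReal.ofReal (s / 2) ≤ μ (upTo s) := by
  induction T using Finset.induction_on_max with
  | empty => exact ⟨0, inferInstance, fun t _ => by simp, by simp, by simp⟩
  | insert a T ha ih =>
    rw [Finset.coe_insert, insert_subset_iff] at hT
    obtain ⟨μ, hfin, hI, hconc, hhalf⟩ := ih hT.2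
    obtain ⟨ha1, hT⟩ := hT
    have hfull : ∀ t ∈ Icc (0 : ℝ) 1, a ≤ t → μ (upTo t) = μ univ := by
      intro t ht hat
      refine measure_congr (Filter.eventuallyEq_univ.2 ?_)
      filter_upwards [hconc] with x hx
      obtain ⟨s, hs, rfl⟩ := hx
      exact (burnAt_mem_upTo ht).2 ((ha s hs).le.trans hat)
    have haI : a ∈ Icc (0 : ℝ) 1 := ⟨ha1.1.le, ha1.2⟩
    have hconc' : ∀ᵐ x ∂μ, ∃ s ∈ insert a T, x = burnAt s := by
      filter_upwards [hconc] with x hx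
      obtain ⟨s, hs, rfl⟩ := hx
      exact ⟨s, Finset.mem_insert_of_mem hs, rfl⟩
    by_cases hlarge : ENNReal.ofReal (a / 2) ≤ μ univ
    · refine ⟨μ, hfin, hI, hconc', fun s hs => ?_⟩
      rcases Finset.mem_insert.1 hs with rfl | hs
      · rwa [hfull _ haI le_rfl]
      · exact hhalf s hs
    have hf2 : 2 * μ univ ≤ ENNReal.ofReal a := by
      have : ENNReal.ofReal a = 2 * ENNReal.ofReal (a / 2) := by
        rw [← ENNReal.ofReal_ofNat, ← ENNReal.ofReal_mul (by norm_num)]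
        congr 1
        ring
      rw [this]
      gcongr
      exact (not_le.1 hlarge).le
    set d : ℝ≥0∞ := ENNReal.ofReal a - 2 * μ univ with hd
    have had : ENNReal.ofReal a = 2 * μ univ + d := (add_tsub_cancel_of_le hf2).symm
    have hdtop : d ≠ ⊤ := ne_top_of_le_ne_top ENNReal.ofReal_ne_top tsub_le_self
    have hval : ∀ t ∈ Icc (0 : ℝ) 1, (μ + d • Measure.dirac (burnAt a)) (upTo t) =
        μ (upTo t) + if a ≤ t then d else 0 := by
      intro t ht
      rw [Measure.add_apply, Measure.smul_apply, Measure.dirac_apply' _ (measurableSet_upTo t)]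
      split_ifs with h
      · rw [indicator_of_mem ((burnAt_mem_upTo ht).2 h)]; simp
      · rw [indicator_of_notMem fun h' => h ((burnAt_mem_upTo ht).1 h')]; simp
    have hdirac : IsFiniteMeasure (d • Measure.dirac (burnAt a)) :=
      ⟨by simpa using hdtop.lt_top⟩
    refine ⟨μ + d • Measure.dirac (burnAt a), inferInstance, fun t ht => ?_, ?_, fun s hs => ?_⟩
    · rw [hval t ht, Measure.restrict_add, lintegral_add_measure, hI t ht, Measure.restrict_smul,
        lintegral_smul_measure, ← lintegral_indicator (measurableSet_upTo t), lintegral_dirac]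
      split_ifs with h
      · rw [indicator_of_mem ((burnAt_mem_upTo ht).2 h), coe_burnAt ha1.2, had, hfull t ht h,
          smul_eq_mul]
        ring
      · rw [indicator_of_notMem fun h' => h ((burnAt_mem_upTo ht).1 h')]
        simp
    · rw [ae_add_measure_iff]
      refine ⟨hconc', Measure.ae_smul_measure ?_ _⟩
      rw [ae_dirac_eq]
      exact ⟨a, Finset.mem_insert_self _ _, rfl⟩
    · rcases Finset.mem_insert.1 hs with rfl | hs
      · rw [hval _ haI, if_pos le_rfl, hfull _ haI le_rfl]
        -- The new total m + d = a - m is at least a/2.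
        have : ENNReal.ofReal s ≤ 2 * (μ univ + d) := by
          rw [had, mul_add]
          gcongr
          exact le_mul_of_one_le_left' one_le_two
        rw [ENNReal.ofReal_div_of_pos two_pos, ENNReal.ofReal_ofNat]
        exact ENNReal.div_le_of_le_mul' this
      · rw [hval _ ⟨(hT hs).1.le, (hT hs).2⟩]
        exact (hhalf s hs).trans le_self_add

/-- The net consists of the minima of Ξ in the cells [kε, (k+1)ε]. Its points must lie below those
they approximate, since criticality is transferred to the right by monotonicity. -/
theorem IsRelClosed.exists_finset {Ξ : Set ℝ} (h : IsRelClosed Ξ) {ε : ℝ} (hε : 0 < ε) :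
    ∃ T : Finset ℝ, (T : Set ℝ) ⊆ Ξ ∧ ∀ x ∈ Ξ, x ≤ ε ∨ ∃ y ∈ T, y ≤ x ∧ x ≤ y + ε := by
  classical
  let S : ℕ → Set ℝ := fun k => Ξ ∩ Icc (k * ε) ((k + 1) * ε)
  -- The filter discards empty cells, where `sInf` is 0, and the cell k = 0 if its infimum is not
  -- attained. Cells with k ≥ 1 avoid 0, so they meet Ξ in a compact set.
  refine ⟨((Finset.range (⌊1 / ε⌋₊ + 1)).image fun k => sInf (S k)).filter (· ∈ Ξ), ?_, ?_⟩
  · intro x hx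
    exact (Finset.mem_filter.1 hx).2
  · intro x hx
    by_cases hxε : x ≤ ε
    · exact Or.inl hxε
    right
    have hk1 : 1 ≤ ⌊x / ε⌋₊ := Nat.le_floor (by
      rw [Nat.cast_one, one_le_div hε]
      exact (not_le.1 hxε).le)
    have hk2 : ⌊x / ε⌋₊ ≤ ⌊1 / ε⌋₊ := Nat.floor_le_floor (by
      gcongr
      exact (h.1 hx).2)
    have hl : (⌊x / ε⌋₊ : ℝ) * ε ≤ x :=
      (le_div_iff₀ hε).1 (Nat.floor_le (div_nonneg (h.1 hx).1.le hε.le))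
    have hr : x ≤ (⌊x / ε⌋₊ + 1 : ℝ) * ε := ((div_lt_iff₀ hε).1 (Nat.lt_floor_add_one _)).le
    generalize ⌊x / ε⌋₊ = k at *
    have hkε : 0 < (k : ℝ) * ε := mul_pos (by exact_mod_cast hk1) hε
    have hS : S k = (Ξ ∪ Iic 0) ∩ Icc (k * ε) ((k + 1) * ε) := by
      ext y
      simp only [S, mem_inter_iff, mem_union, mem_Iic, mem_Icc]
      grind
    have hcomp : IsCompact (S k) := by
      rw [hS]
      exact isCompact_Icc.inter_left (isRelClosed_iff.1 h).2
    have hxS : x ∈ S k := ⟨hx, hl, hr⟩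
    have hmem := hcomp.sInf_mem ⟨x, hxS⟩
    refine ⟨sInf (S k), Finset.mem_filter.2 ⟨Finset.mem_image_of_mem _ (Finset.mem_range.2
      (Nat.lt_succ_of_le hk2)), hmem.1⟩, csInf_le hcomp.bddBelow hxS, ?_⟩
    have := hmem.2.1
    linarith

theorem IsRelClosed.exists_integralEq_approx {Ξ : Set ℝ} (h : IsRelClosed Ξ) {ε : ℝ}
    (hε : 0 < ε) :
    ∃ μ : Measure BurnTime, IsFiniteMeasure μ ∧ IntegralEq μ ∧
      (∀ᵐ x ∂μ, ∃ s ∈ Ξ, x = burnAt s) ∧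
      ∀ s ∈ Ξ, ENNReal.ofReal s ≤
        μ (Iic (burnAt s)) + μ (Iio (burnAt s)) + ENNReal.ofReal ε := by
  obtain ⟨T, hT, happ⟩ := h.exists_finset hε
  obtain ⟨μ, hfin, hI, hconc, hhalf⟩ := exists_integralEq_finset T (hT.trans h.1)
  refine ⟨μ, hfin, hI, ?_, fun s hs => ?_⟩
  · filter_upwards [hconc] with x hx
    obtain ⟨s, hs, rfl⟩ := hx
    exact ⟨s, hT hs, rfl⟩
  rcases happ s hs with hsε | ⟨y, hy, hys, hsy⟩
  · exact (ENNReal.ofReal_le_ofReal hsε).trans le_add_self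
  have hyΞ := h.1 (hT hy)
  have h1 := hI.le_Iic_add_Iio hyΞ (hhalf y hy)
  have hle : burnAt y ≤ burnAt s := by
    rw [← mem_Iic, Iic_burnAt (h.1 hs).2]
    exact (burnAt_mem_upTo ⟨(h.1 hs).1.le, (h.1 hs).2⟩).2 hys
  calc ENNReal.ofReal s ≤ ENNReal.ofReal (y + ε) := ENNReal.ofReal_le_ofReal hsy
    _ = ENNReal.ofReal y + ENNReal.ofReal ε := ENNReal.ofReal_add hyΞ.1.le hε.le
    _ ≤ μ (Iic (burnAt y)) + μ (Iio (burnAt y)) + ENNReal.ofReal ε := by gcongr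
    _ ≤ _ := by
      gcongr

/-! ### Passage to the limit -/

/-- Fubini on {x ≤ s ≤ t}: the slice at x has length t - x, and x + (t - x) = t. -/
theorem lintegral_upTo_add_lintegral_Ioc (μ : Measure BurnTime) [IsFiniteMeasure μ] {t : ℝ}
    (ht : t ∈ Icc (0 : ℝ) 1) :
    ∫⁻ x in upTo t, (x : ℝ≥0∞) ∂μ + ∫⁻ s in Ioc 0 t, μ (upTo s) =
      ENNReal.ofReal t * μ (upTo t) := by
  have hA : MeasurableSet {p : BurnTime × ℝ | p.1 ∈ upTo p.2} :=
    measurableSet_le (f := fun p : BurnTime × ℝ => (p.1 : ℝ≥0∞))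
      (g := fun p : BurnTime × ℝ => ENNReal.ofReal p.2) (by fun_prop) (by fun_prop)
  have h1 := Measure.prod_apply (μ := μ.restrict (upTo t)) (ν := volume.restrict (Ioc 0 t)) hA
  have h2 := Measure.prod_apply_symm (μ := μ.restrict (upTo t)) (ν := volume.restrict (Ioc 0 t)) hA
  have e2 : ∫⁻ s in Ioc 0 t, μ (upTo s) = ∫⁻ s in Ioc 0 t,
      μ.restrict (upTo t) ((fun x => (x, s)) ⁻¹' {p : BurnTime × ℝ | p.1 ∈ upTo p.2}) := by
    refine setLIntegral_congr_fun measurableSet_Ioc fun s hs => ?_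
    rw [Measure.restrict_apply (measurable_prodMk_right hA)]
    congr 1
    ext x
    simp only [mem_inter_iff, mem_preimage, mem_ofPred_eq]
    exact (and_iff_left_of_imp fun h => upTo_mono hs.2 h).symm
  rw [e2, ← h2, h1, ← lintegral_add_left (by fun_prop), ← setLIntegral_const]
  refine setLIntegral_congr_fun (measurableSet_upTo t) fun x hx => ?_
  have hne : x ≠ never := by
    rintro rfl
    exact never_notMem_upTo t hx
  obtain ⟨r, hr, rfl⟩ := exists_eq_burnAt hne
  rw [burnAt_mem_upTo ht] at hx
  have hvol : volume.restrict (Ioc 0 t)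
      (Prod.mk (burnAt r) ⁻¹' {p : BurnTime × ℝ | p.1 ∈ upTo p.2}) = ENNReal.ofReal (t - r) := by
    rw [Measure.restrict_apply (measurable_prodMk_left hA)]
    rcases hr.1.eq_or_lt with rfl | hr0
    · rw [← Real.volume_Ioc]
      congr 1
      ext s
      simp only [mem_inter_iff, mem_preimage, mem_ofPred_eq, mem_upTo, coe_burnAt hr.2]
      simp
    · rw [← Real.volume_Icc]
      congr 1
      ext s
      simp only [mem_inter_iff, mem_preimage, mem_ofPred_eq, mem_upTo, coe_burnAt hr.2, mem_Ioc,
        mem_Icc, ENNReal.ofReal_le_ofReal_iff', not_le.2 hr0]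
      grind
  simp only [coe_burnAt hr.2]
  rw [hvol, ← ENNReal.ofReal_add hr.1 (sub_nonneg.2 hx), add_sub_cancel]

/-- This form involves only values of the distribution function, so it survives pointwise limits. -/
theorem integralEq_iff {μ : Measure BurnTime} [IsFiniteMeasure μ] :
    IntegralEq μ ↔ ∀ t ∈ Icc (0 : ℝ) 1,
      μ (upTo t) ^ 2 + ∫⁻ s in Ioc 0 t, μ (upTo s) = ENNReal.ofReal t * μ (upTo t) := by
  refine forall₂_congr fun t ht => ?_
  have hfin : ∫⁻ s in Ioc 0 t, μ (upTo s) ≠ ⊤ := by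
    refine ne_top_of_le_ne_top ?_ (setLIntegral_mono measurable_const
      fun s _ => measure_mono (subset_univ (upTo s)))
    rw [setLIntegral_const]
    exact ENNReal.mul_ne_top (measure_ne_top _ _) (by simp)
  rw [← lintegral_upTo_add_lintegral_Ioc μ ht, ENNReal.add_left_inj hfin, eq_comm]

theorem tendsto_measureReal_upTo (μ : Measure BurnTime) [IsFiniteMeasure μ] (t : ℝ) :
    Tendsto (fun s => μ.real (upTo s)) (𝓝[>] t) (𝓝 (μ.real (upTo t))) := by
  have h := tendsto_measure_biInter_gt (μ := μ) (s := upTo) (a := t)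
    (fun r _ => (measurableSet_upTo r).nullMeasurableSet) (fun i j _ hij => upTo_mono hij)
    ⟨t + 1, by simp, measure_ne_top _ _⟩
  have hI : ⋂ r > t, upTo r = upTo t := by
    ext x
    simp only [mem_iInter]
    refine ⟨fun hx => ?_, fun hx r hr => upTo_mono (le_of_lt hr) hx⟩
    have hlim : Tendsto ENNReal.ofReal (𝓝[>] t) (𝓝 (ENNReal.ofReal t)) :=
      (ENNReal.continuous_ofReal.tendsto t).mono_left nhdsWithin_le_nhds
    refine ge_of_tendsto hlim ?_
    filter_upwards [self_mem_nhdsWithin] with r hr using hx r hr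
  rw [hI] at h
  exact (ENNReal.tendsto_toReal (measure_ne_top _ _)).comp h

/-- A uniform limit of distribution functions of finite measures on `[0,1]` is the distribution
function of such a measure. -/
theorem exists_measure_of_tendstoUniformly {μ : ℕ → Measure BurnTime}
    [∀ n, IsFiniteMeasure (μ n)] {G : ℝ → ℝ}
    (hG : TendstoUniformly (fun n t => (μ n).real (upTo t)) G atTop)
    (h0 : ∀ n, μ n (upTo 0) = 0) {Ξ : Set ℝ} (hΞ : IsRelClosed Ξ)
    (hconc : ∀ n, ∀ᵐ x ∂μ n, ∃ s ∈ Ξ, x = burnAt s) :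
    ∃ ν : Measure BurnTime, IsFiniteMeasure ν ∧ (∀ᵐ x ∂ν, ∃ s ∈ Ξ, x = burnAt s) ∧
      ∀ t ∈ Icc (0 : ℝ) 1, ν (upTo t) = ENNReal.ofReal (G t) := by
  have hlim : ∀ t, Tendsto (fun n => (μ n).real (upTo t)) atTop (𝓝 (G t)) := hG.tendsto_at
  have hmono : Monotone G := fun s t hst =>
    le_of_tendsto_of_tendsto' (hlim s) (hlim t) fun n => measureReal_mono (upTo_mono hst)
  have hneg : ∀ t ≤ 0, G t = 0 := by
    intro t ht
    refine tendsto_nhds_unique (hlim t) (tendsto_const_nhds.congr fun n => ?_)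
    rw [measureReal_def, measure_mono_null (upTo_mono ht) (h0 n), ENNReal.toReal_zero]
  have hone : ∀ t, 1 ≤ t → G t = G 1 := by
    intro t ht
    refine tendsto_nhds_unique (hlim t) ((hlim 1).congr fun n => ?_)
    rw [← upTo_clamp t, clamp, min_eq_right ht, max_eq_right zero_le_one]
  -- Uniformity of the convergence is what preserves right continuity.
  have hcont : ∀ t, ContinuousWithinAt G (Ici t) t := by
    intro t
    refine continuousWithinAt_of_locally_uniform_approx_of_continuousWithinAt self_mem_Ici fun u hu => ?_
    obtain ⟨n, hn⟩ := (hG u hu).exists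
    refine ⟨univ, univ_mem, fun t => (μ n).real (upTo t), ?_, fun s _ => hn s⟩
    rw [← continuousWithinAt_Ioi_iff_Ici]
    exact tendsto_measureReal_upTo (μ n) t
  let S : StieltjesFunction ℝ := ⟨G, hmono, hcont⟩
  have hbot : Tendsto S atBot (𝓝 0) :=
    tendsto_const_nhds.congr' ((eventually_le_atBot 0).mono fun t ht => (hneg t ht).symm)
  have htop : Tendsto S atTop (𝓝 (G 1)) :=
    tendsto_const_nhds.congr' ((eventually_ge_atTop 1).mono fun t ht => (hone t ht).symm)
  have hSfin : IsFiniteMeasure S.measure := S.isFiniteMeasure hbot htop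
  have hIic : ∀ t, S.measure (Iic t) = ENNReal.ofReal (G t) := by
    intro t
    rw [S.measure_Iic hbot, sub_zero]
  have hclosed := (isRelClosed_iff.1 hΞ).2
  -- Around a point of this open set, none of the μ n charges a small interval, so G is constant
  -- there.
  have hnull : S.measure (Ξ ∪ Iic 0)ᶜ = 0 := by
    refine measure_null_of_locally_null _ fun x hx => ?_
    obtain ⟨a, b, hxab, hab⟩ := (mem_nhds_iff_exists_Ioo_subset).1
      (hclosed.isOpen_compl.mem_nhds hx)
    obtain ⟨c, hxc, hcb⟩ := exists_between hxab.2
    refine ⟨Ioc a c, mem_nhdsWithin_of_mem_nhds (Ioc_mem_nhds hxab.1 hxc), ?_⟩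
    have hac : G c = G a := by
      refine tendsto_nhds_unique (hlim c) ((hlim a).congr fun n => ?_)
      refine measureReal_congr ?_
      filter_upwards [hconc n] with x hx
      obtain ⟨s, hs, rfl⟩ := hx
      have hsI := hΞ.1 hs
      refine propext ?_
      change burnAt s ∈ upTo a ↔ burnAt s ∈ upTo c
      refine ⟨fun h => upTo_mono (hxab.1.trans hxc).le h, fun h => ?_⟩
      by_contra hn
      rw [mem_upTo, coe_burnAt hsI.2] at h hn
      have h1 : s ≤ c := by
        rcases ENNReal.ofReal_le_ofReal_iff'.1 h with h | h
        · exact h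
        · exact absurd h (not_le.2 hsI.1)
      have h2 : a < s := by
        by_contra h'
        exact hn (ENNReal.ofReal_le_ofReal (not_lt.1 h'))
      exact hab ⟨h2, h1.trans_lt hcb⟩ (Or.inl hs)
    rw [S.measure_Ioc]
    change ENNReal.ofReal (G c - G a) = 0
    rw [hac, sub_self, ENNReal.ofReal_zero]
  have hae : ∀ᵐ s ∂S.measure, s ∈ Ξ := by
    have h1 : ∀ᵐ s ∂S.measure, s ∈ Ξ ∪ Iic 0 := hnull
    -- G(0) = 0 removes the part (-∞,0] that was adjoined to make Ξ closed.
    have h2 : ∀ᵐ s ∂S.measure, s ∉ Iic (0 : ℝ) := by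
      rw [← measure_eq_zero_iff_ae_notMem, hIic, hneg 0 le_rfl, ENNReal.ofReal_zero]
    filter_upwards [h1, h2] with s hs hs' using hs.resolve_right hs'
  refine ⟨S.measure.map burnAt, inferInstance, ?_, fun t ht => ?_⟩
  · have hne : ∀ᵐ x ∂S.measure.map burnAt, x ≠ never := by
      refine (ae_map_iff measurable_burnAt.aemeasurable (measurableSet_singleton never).compl).2 ?_
      filter_upwards [hae] with s hs h
      have := congrArg Subtype.val h
      rw [coe_burnAt (hΞ.1 hs).2, coe_never] at this
      exact ENNReal.ofReal_ne_top this
    have hmem : ∀ᵐ x ∂S.measure.map burnAt,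
        x = never ∨ ∃ s ∈ Ξ, (x : ℝ≥0∞) = ENNReal.ofReal s := by
      rw [ae_map_iff measurable_burnAt.aemeasurable (measurableSet_burnTimes hΞ)]
      filter_upwards [hae] with s hs
      exact Or.inr ⟨s, hs, coe_burnAt (hΞ.1 hs).2⟩
    filter_upwards [hne, hmem] with x h1 h2
    obtain ⟨s, hs, hxs⟩ := h2.resolve_left h1
    exact ⟨s, hs, Subtype.ext (by rw [hxs, coe_burnAt (hΞ.1 hs).2])⟩
  · rw [Measure.map_apply measurable_burnAt (measurableSet_upTo t), ← hIic]
    congr 1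
    ext s
    exact burnAt_mem_upTo ht

theorem IntegralEq.of_tendsto {μ : ℕ → Measure BurnTime} [∀ n, IsFiniteMeasure (μ n)]
    (hμ : ∀ n, IntegralEq (μ n)) {ν : Measure BurnTime} [IsFiniteMeasure ν]
    (hlim : ∀ t ∈ Icc (0 : ℝ) 1, Tendsto (fun n => μ n (upTo t)) atTop (𝓝 (ν (upTo t)))) :
    IntegralEq ν := by
  rw [integralEq_iff]
  intro t ht
  have hint : Tendsto (fun n => ∫⁻ s in Ioc 0 t, μ n (upTo s)) atTop
      (𝓝 (∫⁻ s in Ioc 0 t, ν (upTo s))) := by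
    refine tendsto_lintegral_of_dominated_convergence (fun _ => 1) (fun n => ?_) (fun n => ?_) ?_ ?_
    · exact (show Monotone fun s => μ n (upTo s) from
        fun s r h => measure_mono (upTo_mono h)).measurable
    · exact Eventually.of_forall fun s => (hμ n).upTo_le_one s
    · simp
    · filter_upwards [ae_restrict_mem measurableSet_Ioc] with s hs
      exact hlim s ⟨hs.1.le, hs.2.trans ht.2⟩
  have hl := (ENNReal.Tendsto.pow (n := 2) (hlim t ht)).add hint
  have hr := ENNReal.Tendsto.const_mul (a := ENNReal.ofReal t) (hlim t ht)
    (Or.inr ENNReal.ofReal_ne_top)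
  exact tendsto_nhds_unique (hl.congr fun n => integralEq_iff.1 (hμ n) t ht) hr

theorem IsRelClosed.exists_isBurningLaw {Ξ : Set ℝ} (h : IsRelClosed Ξ) :
    ∃ ρ : ProbabilityMeasure BurnTime, IsBurningLaw Ξ ρ := by
  have hpos : ∀ n : ℕ, (0 : ℝ) < 1 / ((n : ℝ) + 1) := fun n => by positivity
  choose μ hfin hI hconc hcrit using fun n => h.exists_integralEq_approx (hpos n)
  -- The bound √(2ε) from `IntegralEq.sub_sq_le` with ε = 1/(N+1).
  let b : ℕ → ℝ := fun N => Real.sqrt (2 * (1 / ((N : ℝ) + 1)))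
  have hb : Tendsto b atTop (𝓝 0) := by
    have h1 : Tendsto (fun N : ℕ => 2 * (1 / ((N : ℝ) + 1))) atTop (𝓝 (2 * 0)) :=
      tendsto_one_div_add_atTop_nhds_zero_nat.const_mul 2
    have h2 := (Real.continuous_sqrt.tendsto _).comp h1
    rwa [mul_zero, Real.sqrt_zero] at h2
  -- Each μ n lives on all of Ξ, not only on the net of μ m; hence criticality of μ m was needed on
  -- the whole of Ξ.
  have hcomp : ∀ n m N : ℕ, N ≤ m → ∀ᵐ x ∂μ n, x ≠ never →
      (x : ℝ≥0∞) ≤ μ m (Iic x) + μ m (Iio x) + ENNReal.ofReal (1 / ((N : ℝ) + 1)) := by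
    intro n m N hNm
    filter_upwards [hconc n] with x hx _
    obtain ⟨s, hs, rfl⟩ := hx
    rw [coe_burnAt (h.1 hs).2]
    refine (hcrit m s hs).trans ?_
    gcongr
  have hdist : ∀ t (n m N : ℕ), N ≤ n → N ≤ m →
      dist ((μ n).real (upTo t)) ((μ m).real (upTo t)) ≤ b N := by
    intro t n m N hn hm
    rw [Real.dist_eq]
    exact Real.abs_le_sqrt ((hI n).sub_sq_le (hI m) (hpos N).le (hcomp n m N hm) (hcomp m n N hn) t)
  choose G hG using fun t => cauchySeq_tendsto_of_complete
    (cauchySeq_of_le_tendsto_0 b (hdist t) hb)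
  have hunif : TendstoUniformly (fun n t => (μ n).real (upTo t)) G atTop := by
    rw [Metric.tendstoUniformly_iff]
    intro ε hε
    filter_upwards [hb.eventually (gt_mem_nhds hε)] with n hn t
    refine lt_of_le_of_lt ?_ hn
    refine le_of_tendsto ((hG t).dist tendsto_const_nhds) ?_
    filter_upwards [eventually_ge_atTop n] with m hm using hdist t m n n hm le_rfl
  have h0 : ∀ n, μ n (upTo 0) = 0 := fun n => by
    simpa using (hI n).upTo_le (t := 0) ⟨le_rfl, zero_le_one⟩
  obtain ⟨ν, hν, hνconc, hνG⟩ := exists_measure_of_tendstoUniformly hunif h0 h hconc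
  have hlim : ∀ t ∈ Icc (0 : ℝ) 1, Tendsto (fun n => μ n (upTo t)) atTop (𝓝 (ν (upTo t))) := by
    intro t ht
    rw [hνG t ht]
    refine (ENNReal.tendsto_ofReal (hG t)).congr fun n => ?_
    exact ofReal_measureReal
  have hνI := IntegralEq.of_tendsto hI hlim
  have hnever : ν {never} = 0 := by
    rw [measure_eq_zero_iff_ae_notMem]
    filter_upwards [hνconc] with x hx h'
    obtain ⟨s, hs, rfl⟩ := hx
    have := congrArg Subtype.val (mem_singleton_iff.1 h')
    rw [coe_burnAt (h.1 hs).2, coe_never] at this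
    exact ENNReal.ofReal_ne_top this
  obtain ⟨ρ, h1, h2, h3⟩ := hνI.exists_completion hnever
  refine ⟨ρ, h1, ?_, fun s hs => ?_⟩
  · rw [h2, ae_add_measure_iff]
    constructor
    · filter_upwards [hνconc] with x hx
      obtain ⟨s, hs, rfl⟩ := hx
      exact Or.inr ⟨s, hs, coe_burnAt (h.1 hs).2⟩
    · refine Measure.ae_smul_measure ?_ _
      rw [ae_dirac_eq]
      exact Or.inl rfl
  · have hsI : s ∈ Icc (0 : ℝ) 1 := ⟨(h.1 hs).1.le, (h.1 hs).2⟩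
    rw [h3]
    have hε : Tendsto (fun n : ℕ => ENNReal.ofReal (1 / ((n : ℝ) + 1))) atTop (𝓝 0) := by
      simpa using ENNReal.tendsto_ofReal tendsto_one_div_add_atTop_nhds_zero_nat
    have hl := ((hlim s hsI).add (hlim s hsI)).add hε
    -- Enlarging [0,s) to [0,s] before the limit avoids left limits, whose convergence is not needed
    -- for the half bound.
    have key : ENNReal.ofReal s ≤ ν (upTo s) + ν (upTo s) + 0 := by
      refine ge_of_tendsto' hl fun n => (hcrit n s hs).trans ?_
      rw [← Iic_burnAt hsI.2]
      gcongr
      exact Iio_subset_Iic_self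
    rw [ENNReal.ofReal_div_of_pos two_pos, ENNReal.ofReal_ofNat]
    refine ENNReal.div_le_of_le_mul' ?_
    rwa [two_mul, ← add_zero (_ + _)]

end FrozenPercolation

end

theorem lemma9 :
    -- every solution of the RDE is scalable and its rescalings solve the RDE
    (∀ ρ : ProbabilityMeasure BurnTime, SolvesRDE ρ →
      ρ ∈ scalable ∧
      ∀ t : ℝ, 0 < t → ∃ ν : ProbabilityMeasure BurnTime,
        (ν : Measure BurnTime).toSignedMeasure = Gamma t ρ ∧ SolvesRDE ν) ∧
    -- the law `ρ_Ξ` is well defined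
    (∀ Ξ : Set ℝ, IsRelClosed Ξ → ∃! ρ : ProbabilityMeasure BurnTime, IsBurningLaw Ξ ρ) ∧
    -- `Γ_t ρ_Ξ = ρ_Ξ'`
    (∀ Ξ : Set ℝ, IsRelClosed Ξ → ∀ t : ℝ, 0 < t →
      IsRelClosed (rescale t Ξ) ∧
      ∀ ρ ρ' : ProbabilityMeasure BurnTime, IsBurningLaw Ξ ρ → IsBurningLaw (rescale t Ξ) ρ' →
        Gamma t ρ = (ρ' : Measure BurnTime).toSignedMeasure) := by
  refine ⟨fun ρ hρ => ⟨fun t ht => ((solvesRDE_iff ρ).1 hρ).upTo_le ht, fun t ht => ?_⟩,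
    fun Ξ hΞ => ?_, fun Ξ hΞ t ht => ⟨isRelClosed_rescale hΞ ht, fun ρ ρ' hρ hρ' => ?_⟩⟩
  · obtain ⟨ν, h1, h2, -⟩ := exists_Gamma hρ ht
    exact ⟨ν, h2, h1⟩
  · obtain ⟨ρ, hρ⟩ := hΞ.exists_isBurningLaw
    exact ⟨ρ, hρ, fun ρ' hρ' => hρ'.unique hΞ.1 hρ⟩
  · obtain ⟨ν, h1, h2⟩ := hρ.exists_rescale hΞ ht
    rw [← h2, h1.unique (rescale_subset hΞ.1 ht) hρ']
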